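/- Let $F$ be a finite field with $|F|=p^{\ell}$, where $p$ is a prime and $\ell$ is an even positive integer, and let $\lambda\in F^{\times}$. For an integer $n>1$, a linear subspace $C\subseteq F^n\times F^n$ is called a 2-quasi $\lambda$-constacyclic code (of length $2n$) if $$(c_0,\dots,c_{n-1},c'_0,\dots,c'_{n-1})\in C\implies(\lambda c_{n-1},c_0,\dots,c_{n-2},\lambda c'_{n-1},c'_0,\dots,c'_{n-2})\in C .$$ A code $C\subseteq F^{m}$ is Hermitian self-dual if $C=\{a\in F^{m} : \sum_{i} c_i a_i^{p^{\ell/2}}=0 \text{ for all } c\in C\}$. A class of linear codes over $F$ is called asymptotically good if it contains a sequence $C_1,C_2,\dots$ of codes, $C_i$ of length $m_i$, with $m_i\to\infty$, and there is a real number $\delta>0$ such that for all $i$ the rate $\dim_F(C_i)/m_i$ and the relative minimum distance $\mathrm{d}(C_i)/m_i$ both exceed $\delta$; here $\mathrm{d}(C_i)$ is the minimum Hamming weight of a nonzero codeword. Then the class of all Hermitian self-dual 2-quasi $\lambda$-constacyclic codes over $F$ (with $\lambda$ and $F$ fixed and $n>1$ arbitrary) is asymptotically good if and only if $\lambda^{1+p^{\ell/2}}=1$.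 -/

import Mathlib

open Filter

/-- The minimum weight of a linear code: the least Hamming weight of a nonzero codeword. For a
linear code it equals the minimum Hamming distance. (The zero code gets the value `0`.) -/
noncomputable def minWeight {F ι : Type*} [Field F] [DecidableEq F] [Fintype ι]
    (C : Submodule F (ι → F)) : ℕ :=
  sInf {w : ℕ | ∃ c ∈ C, c ≠ 0 ∧ hammingNorm c = w}

/-- The relative minimum distance: the minimum weight divided by the length of the code. -/
noncomputable def relMinDist {F ι : Type*} [Field F] [DecidableEq F] [Fintype ι]
    (C : Submodule F (ι → F)) : ℝ :=
  (minWeight C : ℝ) / (Fintype.card ι : ℝ)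

/-- The rate: the dimension divided by the length of the code. -/
noncomputable def codeRate {F ι : Type*} [Field F] [Fintype ι]
    (C : Submodule F (ι → F)) : ℝ :=
  (Module.finrank F C : ℝ) / (Fintype.card ι : ℝ)

/-- A class of linear codes, given by a set `𝒞 n` of codes with coordinate set `ι n` for each `n`,
is asymptotically good if it contains a sequence of codes whose lengths go to infinity and whose
rates and relative minimum distances all exceed one positive real number `δ`. -/
def AsymptoticallyGood {F : Type*} [Field F] [DecidableEq F] {ι : ℕ → Type}
    [∀ n, Fintype (ι n)] (𝒞 : ∀ n, Set (Submodule F (ι n → F))) : Prop :=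
  ∃ (n : ℕ → ℕ) (C : ∀ i, Submodule F (ι (n i) → F)),
    (∀ i, C i ∈ 𝒞 (n i)) ∧
    Tendsto (fun i => Fintype.card (ι (n i))) atTop atTop ∧
    ∃ δ : ℝ, 0 < δ ∧ ∀ i, δ < codeRate (C i) ∧ δ < relMinDist (C i)

/-- `(c₀, c₁, …, cₙ₋₁) ↦ (lam cₙ₋₁, c₀, …, cₙ₋₂)`. -/
def constaShift {F : Type*} [Field F] {n : ℕ} (lam : F) (c : Fin n → F) : Fin n → F :=
  fun j => if j.val = 0 then lam * c ⟨n - 1, Nat.sub_lt j.pos Nat.one_pos⟩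
    else c ⟨j.val - 1, lt_of_le_of_lt (Nat.sub_le _ _) j.isLt⟩

/-- A linear code in `Fⁿ × Fⁿ` (words indexed by `Fin n ⊕ Fin n`) is 2-quasi `lam`-constacyclic if
it is invariant under applying the `lam`-constacyclic shift to both halves simultaneously. -/
def IsTwoQuasiConstacyclic {F : Type*} [Field F] {n : ℕ} (lam : F)
    (C : Submodule F (Fin n ⊕ Fin n → F)) : Prop :=
  ∀ c ∈ C, Sum.elim (constaShift lam (fun j => c (Sum.inl j)))
    (constaShift lam (fun j => c (Sum.inr j))) ∈ C

/-- The Galois `p ^ h`-inner product `∑ aᵢ bᵢ ^ (p ^ h)`. -/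
def galoisInner {F ι : Type*} [Field F] [Fintype ι] (p h : ℕ) (a b : ι → F) : F :=
  ∑ i, a i * b i ^ p ^ h

/-- The Galois `p ^ h`-dual code. -/
def galoisDual {F ι : Type*} [Field F] [Fintype ι] (p h : ℕ) (C : Submodule F (ι → F)) :
    Set (ι → F) :=
  {a | ∀ c ∈ C, galoisInner p h c a = 0}

/-- `C` equals its Galois `p ^ h`-dual code. -/
def IsGaloisSelfDual {F ι : Type*} [Field F] [Fintype ι] (p h : ℕ)
    (C : Submodule F (ι → F)) : Prop :=
  (C : Set (ι → F)) = galoisDual p h C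

/-- Hermitian self-duality over a field with `p ^ ℓ` elements, `ℓ` even: the case `h = ℓ / 2`. -/
def IsHermitianSelfDual {F ι : Type*} [Field F] [Fintype ι] (p ℓ : ℕ)
    (C : Submodule F (ι → F)) : Prop :=
  IsGaloisSelfDual p (ℓ / 2) C

/-- The Hermitian self-dual 2-quasi `lam`-constacyclic codes of length `2n`, `n > 1`, over a field
`F` with `p ^ ℓ` elements. -/
def hermitianSelfDualTwoQuasi (F : Type*) [Field F] (p ℓ : ℕ) (lam : F) (n : ℕ) :
    Set (Submodule F (Fin n ⊕ Fin n → F)) :=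
  {C | 1 < n ∧ IsTwoQuasiConstacyclic lam C ∧ IsHermitianSelfDual p ℓ C}

/-!
Write `q = p ^ (ℓ / 2)`, so that `|F| = q²` and `σ(x) = x ^ q` is an involution of `F`, and let `T`
be the `λ`-constacyclic shift of `Fⁿ`. The condition in the theorem says that `λ σ(λ) = 1`.

*Necessity.* The dual of a 2-quasi `λ`-constacyclic code is 2-quasi `σ(λ)⁻¹`-constacyclic
(`pairShift_mem_of_selfDual`). If `λ ≠ σ(λ)⁻¹`, a self-dual code is invariant under two different
shifts, which differ in only two positions, so it contains a nonzero word of weight at most two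
(`minWeight_le_two_of_pairShift_mem`). Hence the relative distances tend to zero.

*Sufficiency.* If `λ σ(λ) = 1`, then `T` is unitary. Take `n = pᵏ` and `μⁿ = λ`; then `N = T - μ`
satisfies `Nⁿ = 0`. Every operator `M = ∑ aᵢ Nⁱ` commutes with its adjoint `M'` and is invertible
if `a₀ ≠ 0`. With `β σ(β) = -1`, the code `{(M' v, β M v)}` is then Hermitian self-dual and 2-quasi
constacyclic (`mem_pairCode_iff_of_adjoint`, `isTwoQuasiConstacyclic_pairCode`). It remains to
choose `a` so that the code has no nonzero light word, that is, none of weight at most `n / (2K)`,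
where `K` is a constant depending only on `F`. This is a count.

* A nonzero codeword `(x, y)` satisfies `β M x = M' y`. If `d` is minimal with `Nᵈ x = 0`, then for
  fixed `(x, y)` at most `q²ⁿ⁻ᵈ` of the `q²ⁿ` vectors `a` satisfy this equation
  (`card_endComb_eq_le`): it is additive in `a`, and if `a` and `ω a` are both solutions, with
  `σ(ω) ≠ ω`, then `M x = 0`.
* Both `x` and `y` lie in `ker Nᵈ`, for which any `d` consecutive positions form an information set
  (`eq_zero_of_window_eq_zero`). Averaging over the `n` cyclic windows of length `d` bounds the
  number of light pairs in `ker Nᵈ` by twice the number of words of length `2d` and weight at most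
  `d / K` (`card_lightPairs_le`), which is at most `(3/2)ᵈ` (`card_hammingNorm_mul_le`). The same
  averaging shows that there are no nonzero light pairs unless `d ≥ 2K`
  (`two_mul_le_of_mem_lightPairs`).

So the vectors `a` to be avoided make up a proportion of at most `∑ 2 (3/2)ᵈ q⁻ᵈ`, summed over
`d ≥ 2K`. As `q ≥ 2`, this is a tail of a convergent geometric series, and it is smaller than the
proportion of the `a` with `a₀ ≠ 0` (`exists_endComb_avoiding_lightPairs`).
-/

/-! ### The constacyclic shift as a linear map -/

section Shift

variable {F : Type*} [Field F] {n : ℕ}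

/-- The constacyclic shift as a linear endomorphism of `Fⁿ`. -/
def shiftEnd (n : ℕ) (lam : F) : Module.End F (Fin n → F) where
  toFun := constaShift lam
  map_add' u v := by
    funext j
    simp only [constaShift, Pi.add_apply]
    split_ifs <;> ring
  map_smul' r u := by
    funext j
    simp only [constaShift, Pi.smul_apply, smul_eq_mul, RingHom.id_apply]
    split_ifs <;> ring

theorem shiftEnd_apply (lam : F) (u : Fin n → F) : shiftEnd n lam u = constaShift lam u := rfl

theorem shiftEnd_pow_apply (lam : F) (u : Fin n → F) (k : ℕ) (hk : k ≤ n) (j : Fin n) :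
    (shiftEnd n lam ^ k) u j =
      if h : j.val < k then lam * u ⟨j.val + n - k, by omega⟩ else u ⟨j.val - k, by omega⟩ := by
  induction k generalizing j with
  | zero => simp
  | succ k ih =>
    rw [pow_succ', Module.End.mul_apply, shiftEnd_apply, constaShift]
    by_cases hj : j.val = 0
    · rw [if_pos hj, ih (by omega), dif_neg (by simp only; omega), dif_pos (by omega)]
      congr 2
      ext
      simp only
      omega
    · rw [if_neg hj, ih (by omega)]
      by_cases hjk : j.val < k + 1
      · rw [dif_pos (by simp only; omega), dif_pos hjk]
        congr 2
        ext
        simp only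
        omega
      · rw [dif_neg (by simp only; omega), dif_neg hjk]
        congr 1
        ext
        simp only
        omega

theorem shiftEnd_pow_card (lam : F) : shiftEnd n lam ^ n = lam • (1 : Module.End F (Fin n → F)) := by
  refine LinearMap.ext fun u => funext fun j => ?_
  rw [shiftEnd_pow_apply lam u n le_rfl, dif_pos j.isLt]
  simp

/-- Over the `n` iterates of the shift, the entry in a fixed position is nonzero exactly as often
as the word has nonzero entries. -/
theorem card_shiftEnd_pow_ne_zero [DecidableEq F] {lam : F} (hlam : lam ≠ 0) (u : Fin n → F)
    (j : Fin n) :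
    (Finset.univ.filter fun i : Fin n => (shiftEnd n lam ^ i.val) u j ≠ 0).card
      = hammingNorm u := by
  have : NeZero n := ⟨by have := j.pos; omega⟩
  unfold hammingNorm
  refine Finset.card_equiv (Equiv.subLeft j) fun i => ?_
  simp only [Finset.mem_filter, Finset.mem_univ, true_and, Equiv.subLeft_apply]
  rw [shiftEnd_pow_apply lam u i.val i.isLt.le j]
  by_cases h : j.val < i.val
  · rw [dif_pos h]
    have : j - i = ⟨j.val + n - i.val, by omega⟩ := by
      ext
      have := Fin.coe_sub_iff_lt.2 (Fin.lt_def.2 h)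
      simp only
      omega
    rw [this]
    simp [hlam]
  · rw [dif_neg h]
    have : j - i = ⟨j.val - i.val, by omega⟩ := by
      ext
      rw [Fin.sub_val_of_le (by simpa using h)]
    rw [this]

end Shift

/-! ### Sesquilinear forms and the shift -/

section Form

variable {F ι : Type*} [Field F] [Fintype ι]

/-- The sesquilinear form `∑ uᵢ σ(vᵢ)` attached to a ring endomorphism `σ` of the field. -/
def sesqForm (σ : F →+* F) (u v : ι → F) : F := ∑ i, u i * σ (v i)

theorem sesqForm_add_left (σ : F →+* F) (u u' v : ι → F) :
    sesqForm σ (u + u') v = sesqForm σ u v + sesqForm σ u' v := by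
  simp [sesqForm, add_mul, Finset.sum_add_distrib]

theorem sesqForm_add_right (σ : F →+* F) (u v v' : ι → F) :
    sesqForm σ u (v + v') = sesqForm σ u v + sesqForm σ u v' := by
  simp [sesqForm, mul_add, Finset.sum_add_distrib]

theorem sesqForm_smul_left (σ : F →+* F) (r : F) (u v : ι → F) :
    sesqForm σ (r • u) v = r * sesqForm σ u v := by
  simp [sesqForm, Finset.mul_sum, mul_assoc]

theorem sesqForm_smul_right (σ : F →+* F) (r : F) (u v : ι → F) :
    sesqForm σ u (r • v) = σ r * sesqForm σ u v := by
  simp [sesqForm, Finset.mul_sum, mul_left_comm]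

theorem sesqForm_sum_left {κ : Type*} (σ : F →+* F) (s : Finset κ) (f : κ → ι → F) (v : ι → F) :
    sesqForm σ (∑ k ∈ s, f k) v = ∑ k ∈ s, sesqForm σ (f k) v := by
  simp only [sesqForm, Finset.sum_apply, Finset.sum_mul]
  exact Finset.sum_comm

theorem sesqForm_sum_right {κ : Type*} (σ : F →+* F) (s : Finset κ) (f : κ → ι → F) (u : ι → F) :
    sesqForm σ u (∑ k ∈ s, f k) = ∑ k ∈ s, sesqForm σ u (f k) := by
  simp only [sesqForm, Finset.sum_apply, map_sum, Finset.mul_sum]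
  exact Finset.sum_comm

theorem sesqForm_symm {σ : F →+* F} (hσ : ∀ x, σ (σ x) = x) (u v : ι → F) :
    σ (sesqForm σ u v) = sesqForm σ v u := by
  simp [sesqForm, hσ, mul_comm]

theorem eq_zero_of_sesqForm_eq_zero {σ : F →+* F} {v : ι → F}
    (h : ∀ u, sesqForm σ u v = 0) : v = 0 := by
  classical
  funext i
  have := h (Pi.single i 1)
  simpa [sesqForm, Pi.single_apply] using this

theorem sesqForm_sumElim {κ : Type*} [Fintype κ] (σ : F →+* F) (u v : ι ⊕ κ → F) :
    sesqForm σ u v = sesqForm σ (fun i => u (Sum.inl i)) (fun i => v (Sum.inl i))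
      + sesqForm σ (fun i => u (Sum.inr i)) (fun i => v (Sum.inr i)) := by
  simp [sesqForm, Fintype.sum_sum_type]

theorem sesqForm_shiftEnd {σ : F →+* F} {n : ℕ} {lam mu : F} (h : lam * σ mu = 1)
    (u v : Fin n → F) : sesqForm σ (shiftEnd n lam u) (shiftEnd n mu v) = sesqForm σ u v := by
  cases n with
  | zero => simp [sesqForm]
  | succ m =>
    simp only [sesqForm, shiftEnd_apply]
    rw [Fin.sum_univ_succ, Fin.sum_univ_castSucc, add_comm]
    congr 1
    simp only [constaShift, Fin.val_zero, if_true, map_mul]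
    calc _ = (lam * σ mu) * (u ⟨m + 1 - 1, by omega⟩ * σ (v ⟨m + 1 - 1, by omega⟩)) := by ring
      _ = _ := by rw [h, one_mul]; rfl

end Form

/-! ### Only `λ` of norm one gives good codes -/

section Necessity

variable {F : Type*} [Field F] {n : ℕ}

/-- The simultaneous constacyclic shift of both halves of a word. -/
def pairShift (n : ℕ) (lam : F) : Module.End F (Fin n ⊕ Fin n → F) where
  toFun c := Sum.elim (shiftEnd n lam fun j => c (Sum.inl j)) (shiftEnd n lam fun j => c (Sum.inr j))
  map_add' c c' := by
    have h := (shiftEnd n lam).map_add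
    funext j
    cases j
    · exact congrFun (h (fun j => c (Sum.inl j)) fun j => c' (Sum.inl j)) _
    · exact congrFun (h (fun j => c (Sum.inr j)) fun j => c' (Sum.inr j)) _
  map_smul' r c := by
    have h := (shiftEnd n lam).map_smul
    funext j
    cases j
    · exact congrFun (h r fun j => c (Sum.inl j)) _
    · exact congrFun (h r fun j => c (Sum.inr j)) _

theorem pairShift_pow_apply (lam : F) (k : ℕ) (c : Fin n ⊕ Fin n → F) :
    (pairShift n lam ^ k) c = Sum.elim ((shiftEnd n lam ^ k) fun j => c (Sum.inl j))
      ((shiftEnd n lam ^ k) fun j => c (Sum.inr j)) := by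
  induction k with
  | zero => funext j; cases j <;> rfl
  | succ k ih =>
    rw [pow_succ', Module.End.mul_apply, ih, pow_succ', Module.End.mul_apply, Module.End.mul_apply]
    rfl

/-- A self-dual 2-quasi `λ`-constacyclic code is also 2-quasi `σ(λ)⁻¹`-constacyclic. -/
theorem pairShift_mem_of_selfDual {σ : F →+* F} {lam mu : F} (hlam : lam ≠ 0)
    (h : lam * σ mu = 1) {C : Submodule F (Fin n ⊕ Fin n → F)}
    (hC : IsTwoQuasiConstacyclic lam C) (hdual : ∀ a, a ∈ C ↔ ∀ c ∈ C, sesqForm σ c a = 0)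
    {a : Fin n ⊕ Fin n → F} (ha : a ∈ C) : pairShift n mu a ∈ C := by
  rcases Nat.eq_zero_or_pos n with rfl | hn
  · rwa [Subsingleton.elim (pairShift 0 mu a) a]
  rw [hdual]
  intro c hc
  have hpow : ∀ k, (pairShift n lam ^ k) c ∈ C := by
    intro k
    induction k with
    | zero => exact hc
    | succ k ih =>
      rw [pow_succ', Module.End.mul_apply]
      exact hC _ ih
  -- `lam⁻¹ Tⁿ⁻¹ c` is a preimage of `c` under the shift, as `Tⁿ = lam`.
  obtain ⟨c', hc', hcc⟩ : ∃ c' ∈ C, pairShift n lam c' = c := by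
    refine ⟨lam⁻¹ • (pairShift n lam ^ (n - 1)) c, C.smul_mem _ (hpow _), ?_⟩
    rw [map_smul, ← Module.End.mul_apply, ← pow_succ', Nat.sub_add_cancel hn, pairShift_pow_apply,
      shiftEnd_pow_card]
    funext j
    cases j <;> simp [hlam]
  have key : sesqForm σ (pairShift n lam c') (pairShift n mu a) = sesqForm σ c' a := by
    rw [sesqForm_sumElim, sesqForm_sumElim σ c' a,
      ← sesqForm_shiftEnd h (fun j => c' (Sum.inl j)) (fun j => a (Sum.inl j)),
      ← sesqForm_shiftEnd h (fun j => c' (Sum.inr j)) (fun j => a (Sum.inr j))]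
    rfl
  rw [← hcc, key]
  exact (hdual a).1 ha c' hc'

theorem minWeight_le_two_of_pairShift_mem [DecidableEq F] {lam mu : F} (hne : lam ≠ mu)
    {C : Submodule F (Fin n ⊕ Fin n → F)} (hC : ∀ a ∈ C, pairShift n lam a ∈ C)
    (hC' : ∀ a ∈ C, pairShift n mu a ∈ C) (hbot : C ≠ ⊥) : minWeight C ≤ 2 := by
  obtain ⟨c, hc, hc0⟩ := C.ne_bot_iff.1 hbot
  obtain ⟨i, hi⟩ := Function.ne_iff.1 hc0
  rw [Pi.zero_apply] at hi
  have hn : 0 < n := by rcases i with i | i <;> exact i.pos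
  have hpow : ∀ k, (pairShift n lam ^ k) c ∈ C := by
    intro k
    induction k with
    | zero => exact hc
    | succ k ih =>
      rw [pow_succ', Module.End.mul_apply]
      exact hC _ ih
  let l : Fin n := ⟨n - 1, by omega⟩
  obtain ⟨a, ha, hal⟩ : ∃ a ∈ C, a (Sum.inl l) ≠ 0 ∨ a (Sum.inr l) ≠ 0 := by
    rcases i with i | i
    · refine ⟨_, hpow (n - 1 - i.val), Or.inl ?_⟩
      rw [pairShift_pow_apply, Sum.elim_inl, shiftEnd_pow_apply _ _ _ (by omega),
        dif_neg (by simp only [l]; omega)]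
      convert hi using 3
      ext
      simp only [l]
      omega
    · refine ⟨_, hpow (n - 1 - i.val), Or.inr ?_⟩
      rw [pairShift_pow_apply, Sum.elim_inr, shiftEnd_pow_apply _ _ _ (by omega),
        dif_neg (by simp only [l]; omega)]
      convert hi using 3
      ext
      simp only [l]
      omega
  let z : Fin n := ⟨0, hn⟩
  set w := pairShift n lam a - pairShift n mu a with hw
  have hwl : w (Sum.inl z) = (lam - mu) * a (Sum.inl l) := by
    simp [hw, pairShift, shiftEnd_apply, constaShift, z, l, sub_mul]
  have hwr : w (Sum.inr z) = (lam - mu) * a (Sum.inr l) := by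
    simp [hw, pairShift, shiftEnd_apply, constaShift, z, l, sub_mul]
  have hw0 : w ≠ 0 := by
    intro h0
    rw [h0] at hwl hwr
    rcases hal with h | h
    · exact mul_ne_zero (sub_ne_zero.2 hne) h hwl.symm
    · exact mul_ne_zero (sub_ne_zero.2 hne) h hwr.symm
  have hwt : hammingNorm w ≤ 2 := by
    have hsub : (Finset.univ.filter fun i => w i ≠ 0) ⊆ {Sum.inl z, Sum.inr z} := by
      intro j hj
      rw [Finset.mem_filter] at hj
      by_contra hcon
      apply hj.2
      rcases j with j | j <;>
      · have : j.val ≠ 0 := by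
          rintro h0
          apply hcon
          have : j = z := Fin.ext h0
          simp [this]
        simp [hw, pairShift, shiftEnd_apply, constaShift, this]
    exact (Finset.card_le_card hsub).trans Finset.card_le_two
  have hmem : hammingNorm w ∈ {k : ℕ | ∃ c ∈ C, c ≠ 0 ∧ hammingNorm c = k} :=
    ⟨w, C.sub_mem (hC a ha) (hC' a ha), hw0, rfl⟩
  exact (Nat.sInf_le hmem).trans hwt

end Necessity

/-! ### Counting words of small weight -/

section Weight

variable {F ι : Type*} [Field F] [Fintype F] [DecidableEq F] [Fintype ι]

/-- The weight enumerator of the full space. -/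
theorem sum_pow_hammingNorm [DecidableEq ι] (t : ℝ) :
    ∑ v : ι → F, t ^ hammingNorm v = (1 + (Fintype.card F - 1 : ℝ) * t) ^ Fintype.card ι := by
  have h1 : ∀ v : ι → F, t ^ hammingNorm v = ∏ i, (if v i ≠ 0 then t else 1) := by
    intro v
    rw [Finset.prod_ite, Finset.prod_const, Finset.prod_const_one, mul_one]
    rfl
  have h2 : ∑ a : F, (if a ≠ 0 then t else 1) = 1 + (Fintype.card F - 1 : ℝ) * t := by
    rw [← Finset.add_sum_erase _ _ (Finset.mem_univ (0 : F))]
    rw [Finset.sum_congr rfl (g := fun _ => t) (by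
      intro a ha
      rw [if_pos (Finset.ne_of_mem_erase ha)])]
    rw [Finset.sum_const, Finset.card_erase_of_mem (Finset.mem_univ _), Finset.card_univ,
      nsmul_eq_mul, Nat.cast_sub Fintype.card_pos]
    simp
  simp_rw [h1, ← h2]
  rw [← Finset.card_univ, ← Finset.prod_const, Finset.prod_univ_sum, Fintype.piFinset_univ]

/-- If `K` is large in terms of the size of the field, the words of length `2d` and weight at most
`d / K` number at most `(3/2)ᵈ`. -/
theorem card_hammingNorm_mul_le {d K : ℕ} (hK : (20 * Fintype.card F : ℝ) ≤ (4 / 3) ^ K) :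
    ((Finset.univ.filter fun v : Fin d ⊕ Fin d → F => hammingNorm v * K ≤ d).card : ℝ)
      ≤ (3 / 2) ^ d := by
  set Q : ℝ := (Fintype.card F : ℝ) with hQ
  have hQ1 : 1 ≤ Q := by
    rw [hQ]
    exact_mod_cast Fintype.card_pos
  -- The parameter of the weight enumerator balances the two factors below.
  set t : ℝ := (20 * Q)⁻¹ with ht
  have ht0 : 0 < t := by positivity
  have h1 : ∀ v ∈ Finset.univ.filter fun v : Fin d ⊕ Fin d → F => hammingNorm v * K ≤ d,
      (1 : ℝ) ≤ (4 / 3) ^ d * t ^ hammingNorm v := by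
    intro v hv
    have hv := (Finset.mem_filter.1 hv).2
    have h2 : (20 * Q) ^ hammingNorm v ≤ (4 / 3 : ℝ) ^ d := by
      calc (20 * Q) ^ hammingNorm v ≤ ((4 / 3 : ℝ) ^ K) ^ hammingNorm v := by gcongr
        _ = (4 / 3 : ℝ) ^ (hammingNorm v * K) := by rw [← pow_mul, mul_comm]
        _ ≤ (4 / 3 : ℝ) ^ d := pow_le_pow_right₀ (by norm_num) hv
    rw [ht, inv_pow, ← div_eq_mul_inv, one_le_div (by positivity)]
    exact h2
  have h3 : (1 + (Q - 1) * t) ^ 2 ≤ 9 / 8 := by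
    have h4 : (Q - 1) * t ≤ 1 / 20 := by
      rw [ht, ← div_eq_mul_inv, div_le_iff₀ (by positivity)]
      linarith
    have h5 : 0 ≤ (Q - 1) * t := mul_nonneg (by linarith) ht0.le
    nlinarith
  calc ((Finset.univ.filter fun v : Fin d ⊕ Fin d → F => hammingNorm v * K ≤ d).card : ℝ)
      = ∑ v ∈ Finset.univ.filter fun v : Fin d ⊕ Fin d → F => hammingNorm v * K ≤ d, (1 : ℝ) := by
        simp
    _ ≤ ∑ v ∈ Finset.univ.filter fun v : Fin d ⊕ Fin d → F => hammingNorm v * K ≤ d,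
          (4 / 3) ^ d * t ^ hammingNorm v := Finset.sum_le_sum h1
    _ ≤ ∑ v : Fin d ⊕ Fin d → F, (4 / 3) ^ d * t ^ hammingNorm v :=
        Finset.sum_le_sum_of_subset_of_nonneg (Finset.filter_subset _ _)
          fun _ _ _ => by positivity
    _ = (4 / 3) ^ d * ((1 + (Q - 1) * t) ^ 2) ^ d := by
        rw [← Finset.mul_sum, sum_pow_hammingNorm, ← pow_mul, Fintype.card_sum, Fintype.card_fin,
          two_mul]
    _ ≤ (4 / 3) ^ d * (9 / 8) ^ d := by gcongr
    _ = (3 / 2) ^ d := by rw [← mul_pow]; norm_num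

end Weight

/-! ### Kernels of powers of `T - μ` -/

section Window

variable {F : Type*} [Field F] {n : ℕ}

/-- For `n = pᵏ` the operator `T - μ`, where `μⁿ = λ`, is nilpotent. -/
theorem shiftEnd_sub_pow_eq_zero {p : ℕ} [Fact p.Prime] [CharP F p] {k : ℕ} {lam mu : F}
    (hmu : mu ^ p ^ k = lam) : (shiftEnd (p ^ k) lam - mu • 1) ^ p ^ k = 0 := by
  have h : (Polynomial.X - Polynomial.C mu) ^ p ^ k
      = Polynomial.X ^ p ^ k - Polynomial.C lam := by
    rw [sub_pow_char_pow, ← Polynomial.C_pow, hmu]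
  have h2 := congrArg (Polynomial.aeval (shiftEnd (p ^ k) lam)) h
  simpa [Algebra.algebraMap_eq_smul_one, shiftEnd_pow_card] using h2

/-- A window of `d` consecutive positions is an information set for `ker (T - μ)ᵈ`. -/
theorem eq_zero_of_window_eq_zero {lam mu : F} (hmu : mu ≠ 0) (d : ℕ) :
    ∀ (s : ℕ) (_ : s + d ≤ n) (u : Fin n → F) (_ : ((shiftEnd n lam - mu • 1) ^ d) u = 0)
      (_ : ∀ j : Fin n, s ≤ j.val → j.val < s + d → u j = 0), u = 0 := by
  induction d with
  | zero =>
    intro s _ u hu _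
    simpa using hu
  | succ d ih =>
    intro s hs u hu hz
    have hrec : ∀ (i : ℕ) (hi : i + 1 < n), ((shiftEnd n lam - mu • 1) u) ⟨i + 1, hi⟩
        = u ⟨i, by omega⟩ - mu * u ⟨i + 1, hi⟩ := by
      intro i hi
      simp [shiftEnd_apply, constaShift]
    have hw : (shiftEnd n lam - mu • 1) u = 0 := by
      refine ih (s + 1) (by omega) _ ?_ ?_
      · rw [← Module.End.mul_apply, ← pow_succ, hu]
      · rintro ⟨j, hj⟩ h1 h2
        obtain ⟨i, rfl⟩ : ∃ i, j = i + 1 := ⟨j - 1, by simp only at h1; omega⟩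
        simp only at h1 h2
        rw [hrec, hz _ (by simp only; omega) (by simp only; omega),
          hz _ (by simp only; omega) (by simp only; omega)]
        simp
    have hstep : ∀ (i : ℕ) (hi : i + 1 < n), u ⟨i, by omega⟩ = mu * u ⟨i + 1, hi⟩ := by
      intro i hi
      have := hrec i hi
      rw [hw] at this
      exact (sub_eq_zero.1 this.symm)
    -- Now `u` is a geometric progression vanishing at position `s`.
    have hall : ∀ (i : ℕ) (hi : i < n), u ⟨i, hi⟩ = 0 ↔ u ⟨0, by omega⟩ = 0 := by
      intro i
      induction i with
      | zero => intro _; rfl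
      | succ i ihi =>
        intro hi
        rw [← ihi (by omega), hstep i hi]
        simp [hmu]
    have h0 : u ⟨0, by omega⟩ = 0 := (hall s (by omega)).1 (hz _ le_rfl (by simp))
    funext j
    exact (hall j.val j.isLt).2 h0

/-- The first `d` entries of both words. -/
def pairWindow (d : ℕ) (hd : d ≤ n) (z : (Fin n → F) × (Fin n → F)) : Fin d ⊕ Fin d → F :=
  Sum.elim (fun j => z.1 (Fin.castLE hd j)) (fun j => z.2 (Fin.castLE hd j))

theorem hammingNorm_sumElim [DecidableEq F] {ι κ : Type*} [Fintype ι] [Fintype κ] (u : ι → F) (v : κ → F) :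
    hammingNorm (Sum.elim u v) = hammingNorm u + hammingNorm v := by
  simp only [hammingNorm, Finset.card_filter, Fintype.sum_sum_type, Sum.elim_inl, Sum.elim_inr]
  rfl

/-- Every position lies in `d` of the `n` cyclic windows of length `d`. -/
theorem sum_hammingNorm_pairWindow [DecidableEq F] {lam : F} (hlam : lam ≠ 0) (d : ℕ) (hd : d ≤ n)
    (z : (Fin n → F) × (Fin n → F)) :
    ∑ i : Fin n, hammingNorm (pairWindow d hd
      ((shiftEnd n lam ^ i.val) z.1, (shiftEnd n lam ^ i.val) z.2))
      = d * (hammingNorm z.1 + hammingNorm z.2) := by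
  have h : ∀ u : Fin n → F, ∑ i : Fin n, hammingNorm
      (fun j : Fin d => (shiftEnd n lam ^ i.val) u (Fin.castLE hd j)) = d * hammingNorm u := by
    intro u
    calc _ = ∑ i : Fin n, ∑ j : Fin d,
          if (shiftEnd n lam ^ i.val) u (Fin.castLE hd j) ≠ 0 then 1 else 0 := by
          simp only [hammingNorm, Finset.card_filter]
      _ = ∑ j : Fin d, ∑ i : Fin n,
          if (shiftEnd n lam ^ i.val) u (Fin.castLE hd j) ≠ 0 then 1 else 0 := Finset.sum_comm
      _ = ∑ j : Fin d, hammingNorm u := by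
          refine Finset.sum_congr rfl fun j _ => ?_
          rw [← Finset.card_filter, card_shiftEnd_pow_ne_zero hlam]
      _ = _ := by simp
  simp only [pairWindow, hammingNorm_sumElim, Finset.sum_add_distrib, h]
  ring

theorem shiftEnd_pow_sub_pow_comm {lam mu : F} {d i : ℕ} {u : Fin n → F}
    (hu : ((shiftEnd n lam - mu • 1) ^ d) u = 0) :
    ((shiftEnd n lam - mu • 1) ^ d) ((shiftEnd n lam ^ i) u) = 0 := by
  have hc : Commute ((shiftEnd n lam - mu • 1) ^ d) (shiftEnd n lam ^ i) := by
    refine Commute.pow_pow ?_ _ _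
    refine (Commute.refl _).sub_left ?_
    exact (Commute.one_left _).smul_left _
  rw [← Module.End.mul_apply, hc.eq, Module.End.mul_apply, hu, map_zero]

theorem shiftEnd_pow_injective {lam : F} (hlam : lam ≠ 0) (k : ℕ) (hk : k ≤ n) :
    Function.Injective (shiftEnd n lam ^ k) := by
  rw [injective_iff_map_eq_zero]
  intro u hu
  have h : (shiftEnd n lam ^ n) u = 0 := by
    have hpow : shiftEnd n lam ^ n = shiftEnd n lam ^ (n - k) * shiftEnd n lam ^ k := by
      rw [← pow_add, Nat.sub_add_cancel hk]
    rw [hpow, Module.End.mul_apply, hu, map_zero]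
  rw [shiftEnd_pow_card] at h
  simpa [hlam] using h

theorem pairWindow_eq_zero {lam mu : F} (hlam : lam ≠ 0) (hmu : mu ≠ 0) {d : ℕ} (hd : d ≤ n)
    {i : ℕ} (hi : i ≤ n) {x y : Fin n → F} (hx : ((shiftEnd n lam - mu • 1) ^ d) x = 0)
    (hy : ((shiftEnd n lam - mu • 1) ^ d) y = 0)
    (h : pairWindow d hd ((shiftEnd n lam ^ i) x, (shiftEnd n lam ^ i) y) = 0) :
    x = 0 ∧ y = 0 := by
  constructor
  · have := eq_zero_of_window_eq_zero hmu d 0 (by omega) ((shiftEnd n lam ^ i) x)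
      (shiftEnd_pow_sub_pow_comm hx) fun j _ hj => congrFun h (Sum.inl ⟨j.val, by omega⟩)
    exact shiftEnd_pow_injective hlam i hi (this.trans (map_zero _).symm)
  · have := eq_zero_of_window_eq_zero hmu d 0 (by omega) ((shiftEnd n lam ^ i) y)
      (shiftEnd_pow_sub_pow_comm hy) fun j _ hj => congrFun h (Sum.inr ⟨j.val, by omega⟩)
    exact shiftEnd_pow_injective hlam i hi (this.trans (map_zero _).symm)

/-- The pairs of words in `ker (T - μ)ᵈ` whose total weight is at most `n / (2K)`. -/
def lightPairs [Fintype F] [DecidableEq F] (n : ℕ) (lam mu : F) (K d : ℕ) : Finset ((Fin n → F) × (Fin n → F)) :=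
  Finset.univ.filter fun z => ((shiftEnd n lam - mu • 1) ^ d) z.1 = 0 ∧
    ((shiftEnd n lam - mu • 1) ^ d) z.2 = 0 ∧ 2 * K * (hammingNorm z.1 + hammingNorm z.2) ≤ n

variable [Fintype F] [DecidableEq F]

/-- A nonzero pair in `ker (T - μ)ᵈ` has no zero window of length `d`, so it can be light only if
`d` is not small. -/
theorem two_mul_le_of_mem_lightPairs {lam mu : F} (hlam : lam ≠ 0) (hmu : mu ≠ 0) {K d : ℕ}
    (hn : 0 < n) (hd : d ≤ n) {z : (Fin n → F) × (Fin n → F)} (hz : z ∈ lightPairs n lam mu K d)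
    (hz0 : z.1 ≠ 0) : 2 * K ≤ d := by
  obtain ⟨-, h1, h2, h3⟩ := Finset.mem_filter.1 hz
  have hle : n ≤ d * (hammingNorm z.1 + hammingNorm z.2) := by
    rw [← sum_hammingNorm_pairWindow hlam d hd z]
    calc n = ∑ i : Fin n, 1 := by simp
      _ ≤ _ := Finset.sum_le_sum fun i _ => by
        rw [Nat.one_le_iff_ne_zero, Ne, hammingNorm_eq_zero]
        exact fun h => hz0 (pairWindow_eq_zero hlam hmu hd i.isLt.le h1 h2 h).1
  have hmul : 2 * K * n ≤ d * n :=
    calc 2 * K * n ≤ 2 * K * (d * (hammingNorm z.1 + hammingNorm z.2)) := by gcongr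
      _ = d * (2 * K * (hammingNorm z.1 + hammingNorm z.2)) := by ring
      _ ≤ d * n := by gcongr
  exact Nat.le_of_mul_le_mul_right hmul hn

/-- For a light pair at least half of the `n` cyclic windows of length `d` have weight at most
twice the average, and for each position of the window such pairs are determined by what they show
in it. -/
theorem card_lightPairs_le {lam mu : F} (hlam : lam ≠ 0) (hmu : mu ≠ 0) {K d : ℕ}
    (hn : 0 < n) (hd0 : 0 < d) (hd : d ≤ n) :
    (lightPairs n lam mu K d).card ≤
      2 * (Finset.univ.filter fun v : Fin d ⊕ Fin d → F => hammingNorm v * K ≤ d).card := by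
  set V := Finset.univ.filter fun v : Fin d ⊕ Fin d → F => hammingNorm v * K ≤ d with hV
  let win : Fin n → (Fin n → F) × (Fin n → F) → (Fin d ⊕ Fin d → F) := fun i z =>
    pairWindow d hd ((shiftEnd n lam ^ i.val) z.1, (shiftEnd n lam ^ i.val) z.2)
  have hmarkov : ∀ z ∈ lightPairs n lam mu K d,
      n ≤ 2 * (Finset.univ.filter fun i : Fin n => win i z ∈ V).card := by
    intro z hz
    obtain ⟨-, h1, h2, h3⟩ := Finset.mem_filter.1 hz
    have hsum := sum_hammingNorm_pairWindow hlam d hd z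
    have hbad : (Finset.univ.filter fun i : Fin n => ¬ win i z ∈ V).card * d
        ≤ K * (d * (hammingNorm z.1 + hammingNorm z.2)) := by
      rw [← hsum, Finset.mul_sum]
      calc _ = ∑ i ∈ Finset.univ.filter fun i : Fin n => ¬ win i z ∈ V, d := by simp
        _ ≤ ∑ i ∈ Finset.univ.filter fun i : Fin n => ¬ win i z ∈ V, K * hammingNorm (win i z) := by
          refine Finset.sum_le_sum fun i hi => ?_
          have := (Finset.mem_filter.1 hi).2
          rw [hV, Finset.mem_filter] at this
          simp only [Finset.mem_univ, true_and, not_le] at this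
          rw [mul_comm]
          exact this.le
        _ ≤ _ := Finset.sum_le_sum_of_subset (Finset.filter_subset _ _)
    have htot := Finset.card_filter_add_card_filter_not (s := (Finset.univ : Finset (Fin n)))
      (fun i : Fin n => win i z ∈ V)
    rw [Finset.card_univ, Fintype.card_fin] at htot
    have hb2 : 2 * (Finset.univ.filter fun i : Fin n => ¬ win i z ∈ V).card ≤ n := by
      refine Nat.le_of_mul_le_mul_right ?_ hd0
      calc 2 * (Finset.univ.filter fun i : Fin n => ¬ win i z ∈ V).card * d
          ≤ 2 * (K * (d * (hammingNorm z.1 + hammingNorm z.2))) := by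
            rw [mul_assoc]; gcongr
        _ = d * (2 * K * (hammingNorm z.1 + hammingNorm z.2)) := by ring
        _ ≤ d * n := by gcongr
        _ = n * d := mul_comm _ _
    omega
  have hinj : ∀ i : Fin n, ((lightPairs n lam mu K d).filter fun z => win i z ∈ V).card
      ≤ V.card := by
    intro i
    refine Finset.card_le_card_of_injOn (win i) (fun z hz => (Finset.mem_filter.1 hz).2) ?_
    intro z hz z' hz' h
    obtain ⟨-, h1, h2, -⟩ := Finset.mem_filter.1 (Finset.mem_filter.1 hz).1
    obtain ⟨-, h1', h2', -⟩ := Finset.mem_filter.1 (Finset.mem_filter.1 hz').1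
    have hsub : pairWindow d hd ((shiftEnd n lam ^ i.val) (z.1 - z'.1),
        (shiftEnd n lam ^ i.val) (z.2 - z'.2)) = 0 := by
      funext j
      have hj := congrFun h j
      rcases j with j | j
      · simpa [win, pairWindow, sub_eq_zero] using hj
      · simpa [win, pairWindow, sub_eq_zero] using hj
    have := pairWindow_eq_zero (mu := mu) hlam hmu hd i.isLt.le
      (by rw [map_sub, h1, h1', sub_zero]) (by rw [map_sub, h2, h2', sub_zero]) hsub
    exact Prod.ext (sub_eq_zero.1 this.1) (sub_eq_zero.1 this.2)
  have hdc : (lightPairs n lam mu K d).card * n ≤ 2 * V.card * n :=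
    calc (lightPairs n lam mu K d).card * n
        = ∑ z ∈ lightPairs n lam mu K d, n := by simp
      _ ≤ ∑ z ∈ lightPairs n lam mu K d,
            2 * (Finset.univ.filter fun i : Fin n => win i z ∈ V).card := Finset.sum_le_sum hmarkov
      _ = 2 * ∑ i : Fin n, ((lightPairs n lam mu K d).filter fun z => win i z ∈ V).card := by
          rw [← Finset.mul_sum]
          simp only [Finset.card_filter]
          rw [Finset.sum_comm]
      _ ≤ 2 * ∑ i : Fin n, V.card := by gcongr with i; exact hinj i
      _ = 2 * V.card * n := by simp; ring
  exact Nat.le_of_mul_le_mul_right hdc hn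

end Window

/-! ### Polynomials in a nilpotent endomorphism -/

section EndComb

variable {F V : Type*} [Field F] [AddCommGroup V] [Module F V] {n : ℕ}

/-- The endomorphism `∑ aᵢ Nⁱ`. -/
def endComb (N : Module.End F V) (a : Fin n → F) : Module.End F V := ∑ i, a i • N ^ i.val

theorem endComb_apply (N : Module.End F V) (a : Fin n → F) (v : V) :
    endComb N a v = ∑ i, a i • (N ^ i.val) v := by
  simp [endComb, LinearMap.sum_apply]

theorem endComb_sub (N : Module.End F V) (a b : Fin n → F) :
    endComb N (a - b) = endComb N a - endComb N b := by
  simp [endComb, sub_smul, Finset.sum_sub_distrib]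

theorem endComb_smul (N : Module.End F V) (r : F) (a : Fin n → F) :
    endComb N (r • a) = r • endComb N a := by
  simp [endComb, Finset.smul_sum, mul_smul]

theorem commute_endComb {A N : Module.End F V} (h : Commute A N) (a : Fin n → F) :
    Commute A (endComb N a) :=
  Commute.sum_right _ _ _ fun i _ => (h.pow_right i.val).smul_right (a i)

/-- If `Nᵈ` is the last power of `N` not killing `x`, then an annihilator of `x` of the form
`∑ aᵢ Nⁱ` has no terms up to `Nᵈ`. -/
theorem coeff_eq_zero_of_endComb_apply_eq_zero {N : Module.End F V} {d : ℕ} {x : V}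
    (hd : (N ^ (d + 1)) x = 0) (hx : (N ^ d) x ≠ 0) {a : Fin n → F} (h : endComb N a x = 0) :
    ∀ (i : ℕ) (hi : i < n), i ≤ d → a ⟨i, hi⟩ = 0 := by
  intro i
  induction i using Nat.strong_induction_on with
  | _ i ih =>
    intro hi hid
    have hkill : ∀ k, d < k → (N ^ k) x = 0 := by
      intro k hk
      obtain ⟨m, rfl⟩ : ∃ m, k = m + (d + 1) := ⟨k - (d + 1), by omega⟩
      rw [pow_add, Module.End.mul_apply, hd, map_zero]
    -- Applying `N ^ (d - i)` isolates the coefficient of `N ^ i`.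
    have h1 : (N ^ (d - i)) (endComb N a x) = a ⟨i, hi⟩ • (N ^ d) x := by
      rw [endComb_apply, map_sum, Finset.sum_eq_single ⟨i, hi⟩]
      · rw [map_smul, ← Module.End.mul_apply, ← pow_add, Nat.sub_add_cancel hid]
      · intro k _ hk
        rw [map_smul, ← Module.End.mul_apply, ← pow_add]
        rcases lt_trichotomy k.val i with hlt | heq | hgt
        · rw [ih k.val hlt k.isLt (by omega), zero_smul]
        · exact absurd (Fin.ext heq) hk
        · rw [hkill _ (by omega), smul_zero]
      · simp
    rw [h, map_zero] at h1
    exact (smul_eq_zero.1 h1.symm).resolve_right hx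

theorem exists_pow_apply_ne_zero {N : Module.End F V} (hN : N ^ n = 0) {x : V} (hx : x ≠ 0) :
    ∃ d < n, (N ^ (d + 1)) x = 0 ∧ (N ^ d) x ≠ 0 := by
  classical
  have hex : ∃ k, (N ^ k) x = 0 := ⟨n, by rw [hN, LinearMap.zero_apply]⟩
  have h0 : Nat.find hex ≠ 0 := by
    intro h
    have := Nat.find_spec hex
    rw [h] at this
    exact hx (by simpa using this)
  have hle : Nat.find hex ≤ n := Nat.find_min' hex (by rw [hN, LinearMap.zero_apply])
  refine ⟨Nat.find hex - 1, by omega, ?_, Nat.find_min hex (by omega)⟩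
  rw [Nat.sub_add_cancel (by omega)]
  exact Nat.find_spec hex

theorem endComb_injective {N : Module.End F V} (hN : N ^ n = 0) {a : Fin n → F} (hn : 0 < n)
    (ha : a ⟨0, hn⟩ ≠ 0) : Function.Injective (endComb N a) := by
  rw [injective_iff_map_eq_zero]
  intro x hx
  by_contra hx0
  obtain ⟨d, -, h1, h2⟩ := exists_pow_apply_ne_zero hN hx0
  exact ha (coeff_eq_zero_of_endComb_apply_eq_zero h1 h2 hx 0 hn (Nat.zero_le _))

end EndComb

section Adjoint

variable {F ι : Type*} [Field F] [Fintype ι] {n : ℕ} {σ : F →+* F}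

theorem sesqForm_pow_adjoint {A A' : Module.End F (ι → F)}
    (h : ∀ u v, sesqForm σ (A u) v = sesqForm σ u (A' v)) (k : ℕ) (u v : ι → F) :
    sesqForm σ ((A ^ k) u) v = sesqForm σ u ((A' ^ k) v) := by
  induction k generalizing u with
  | zero => rfl
  | succ k ih => rw [pow_succ, Module.End.mul_apply, ih, h, pow_succ', Module.End.mul_apply]

theorem sesqForm_endComb_adjoint (hσ : ∀ x, σ (σ x) = x) {N N' : Module.End F (ι → F)}
    (h : ∀ u v, sesqForm σ (N u) v = sesqForm σ u (N' v)) (a : Fin n → F) (u v : ι → F) :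
    sesqForm σ (endComb N a u) v = sesqForm σ u (endComb N' (fun i => σ (a i)) v) := by
  simp only [endComb_apply, sesqForm_sum_left, sesqForm_sum_right, sesqForm_smul_left,
    sesqForm_smul_right, hσ, sesqForm_pow_adjoint h]

theorem sesqForm_adjoint_symm (hσ : ∀ x, σ (σ x) = x) {A A' : Module.End F (ι → F)}
    (h : ∀ u v, sesqForm σ (A u) v = sesqForm σ u (A' v)) (u v : ι → F) :
    sesqForm σ (A' u) v = sesqForm σ u (A v) := by
  rw [← sesqForm_symm hσ v (A' u), ← h, sesqForm_symm hσ]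

theorem adjoint_injective {A A' : Module.End F (ι → F)}
    (h : ∀ u v, sesqForm σ (A u) v = sesqForm σ u (A' v)) (hA : Function.Injective A) :
    Function.Injective A' := by
  have hs : Function.Surjective A := LinearMap.injective_iff_surjective.1 hA
  rw [injective_iff_map_eq_zero]
  intro v hv
  refine eq_zero_of_sesqForm_eq_zero (σ := σ) fun u => ?_
  obtain ⟨w, rfl⟩ := hs u
  rw [h, hv]
  simp [sesqForm]

end Adjoint

/-! ### Self-dual codes from an operator commuting with its adjoint -/

section PairCode

variable {F ι : Type*} [Field F]

/-- The code of all words `(M' v, β M v)`. -/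
def pairCode (M M' : Module.End F (ι → F)) (β : F) : Submodule F (ι ⊕ ι → F) :=
  LinearMap.range ((LinearEquiv.sumArrowLequivProdArrow ι ι F F).symm.toLinearMap ∘ₗ
    M'.prod (β • M))

theorem mem_pairCode {M M' : Module.End F (ι → F)} {β : F} {c : ι ⊕ ι → F} :
    c ∈ pairCode M M' β ↔ ∃ v, Sum.elim (M' v) (β • M v) = c := by
  rfl

theorem finrank_pairCode [Fintype ι] {M M' : Module.End F (ι → F)} {β : F}
    (hM' : Function.Injective M') :
    Module.finrank F (pairCode M M' β) = Fintype.card ι := by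
  rw [pairCode, LinearMap.finrank_range_of_inj, Module.finrank_fintype_fun_eq_card]
  intro v w h
  apply hM'
  funext i
  exact congrFun h (Sum.inl i)

theorem mem_pairCode_iff_of_adjoint [Fintype ι] {σ : F →+* F} (hσ : ∀ x, σ (σ x) = x)
    {M M' : Module.End F (ι → F)} {β : F}
    (hadj : ∀ u v, sesqForm σ (M u) v = sesqForm σ u (M' v)) (hcomm : Commute M M')
    (hM' : Function.Injective M') (hβ : β * σ β = -1) (a : ι ⊕ ι → F) :
    a ∈ pairCode M M' β ↔ ∀ c ∈ pairCode M M' β, sesqForm σ c a = 0 := by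
  have hadj' := sesqForm_adjoint_symm hσ hadj
  have hc : ∀ v, M (M' v) = M' (M v) := fun v => by
    rw [← Module.End.mul_apply, hcomm.eq, Module.End.mul_apply]
  constructor
  · intro ha c hcm
    obtain ⟨v, rfl⟩ := mem_pairCode.1 ha
    obtain ⟨w, rfl⟩ := mem_pairCode.1 hcm
    rw [sesqForm_sumElim]
    simp only [Sum.elim_inl, Sum.elim_inr]
    change sesqForm σ (M' w) (M' v) + sesqForm σ (β • M w) (β • M v) = 0
    rw [sesqForm_smul_left, sesqForm_smul_right, ← mul_assoc, hβ, hadj', hadj, hc]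
    ring
  · intro h
    set y : ι → F := fun i => a (Sum.inl i) with hy
    set z : ι → F := fun i => a (Sum.inr i) with hz
    have h1 : M y + σ β • M' z = 0 := by
      refine eq_zero_of_sesqForm_eq_zero (σ := σ) fun u => ?_
      have := h _ (mem_pairCode.2 ⟨u, rfl⟩)
      rw [sesqForm_sumElim] at this
      change sesqForm σ (M' u) y + sesqForm σ (β • M u) z = 0 at this
      rw [sesqForm_add_right, sesqForm_smul_right, hσ, ← hadj', ← hadj]
      rwa [sesqForm_smul_left] at this
    obtain ⟨v, hv⟩ := LinearMap.injective_iff_surjective.1 hM' y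
    have h2 : M v = -(σ β • z) := by
      apply hM'
      rw [← hc, hv, map_neg, map_smul]
      exact eq_neg_of_add_eq_zero_left h1
    refine mem_pairCode.2 ⟨v, ?_⟩
    funext i
    rcases i with i | i
    · exact congrFun hv i
    · simp only [Sum.elim_inr, h2, Pi.smul_apply, Pi.neg_apply, smul_eq_mul, hz]
      linear_combination (-a (Sum.inr i)) * hβ

theorem isTwoQuasiConstacyclic_pairCode {n : ℕ} {lam β : F}
    {M M' : Module.End F (Fin n → F)} (hM : Commute (shiftEnd n lam) M)
    (hM' : Commute (shiftEnd n lam) M') : IsTwoQuasiConstacyclic lam (pairCode M M' β) := by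
  intro c hcm
  obtain ⟨v, rfl⟩ := mem_pairCode.1 hcm
  refine mem_pairCode.2 ⟨shiftEnd n lam v, ?_⟩
  rw [← Module.End.mul_apply, ← hM'.eq, ← Module.End.mul_apply, ← hM.eq, Module.End.mul_apply,
    Module.End.mul_apply, ← map_smul]
  rfl

end PairCode

/-! ### Counting the operators that produce a given pair -/

section Count

theorem card_sq_le_of_inter_le {G : Type*} [AddCommGroup G] [Fintype G] [DecidableEq G]
    {S K : Finset G} (hsub : ∀ s ∈ S, ∀ t ∈ S, s - t ∈ S) (φ : G →+ G)
    (h : ∀ s ∈ S, φ s ∈ S → s ∈ K) : S.card ^ 2 ≤ K.card * Fintype.card G := by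
  rw [sq, ← Finset.card_product]
  refine Finset.card_le_mul_card_image_of_maps_to (f := fun p : G × G => p.1 + φ p.2)
    (t := Finset.univ) (fun _ _ => Finset.mem_univ _) K.card fun g _ => ?_
  rcases Finset.eq_empty_or_nonempty ((S ×ˢ S).filter fun p : G × G => p.1 + φ p.2 = g) with
    he | ⟨p₀, hp₀⟩
  · rw [he]; simp
  obtain ⟨hp₀, hg₀⟩ := Finset.mem_filter.1 hp₀
  obtain ⟨hs₀, ht₀⟩ := Finset.mem_product.1 hp₀
  refine Finset.card_le_card_of_injOn (fun p => p.2 - p₀.2) ?_ ?_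
  · intro p hp
    obtain ⟨hp, hg⟩ := Finset.mem_filter.1 hp
    obtain ⟨hs, ht⟩ := Finset.mem_product.1 hp
    refine h _ (hsub _ ht _ ht₀) ?_
    have : φ (p.2 - p₀.2) = p₀.1 - p.1 := by
      rw [map_sub, sub_eq_sub_iff_add_eq_add, add_comm, hg, ← hg₀]
    rw [this]
    exact hsub _ hs₀ _ hs
  · intro p hp p' hp' heq
    have hg := (Finset.mem_filter.1 hp).2
    have hg' := (Finset.mem_filter.1 hp').2
    have h2 : p.2 = p'.2 := sub_left_injective heq
    refine Prod.ext ?_ h2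
    rw [← hg', h2] at hg
    exact add_right_cancel hg

variable {F : Type*} [Field F] [Fintype F] [DecidableEq F] {n : ℕ}

theorem card_forall_lt_eq_zero_le (d : ℕ) (hd : d ≤ n) :
    (Finset.univ.filter fun a : Fin n → F => ∀ i : Fin n, i.val < d → a i = 0).card
      ≤ Fintype.card F ^ (n - d) := by
  have hcard : (Finset.univ : Finset (Fin (n - d) → F)).card = Fintype.card F ^ (n - d) := by
    simp
  rw [← hcard]
  refine Finset.card_le_card_of_injOn (fun a j => a ⟨d + j.val, by omega⟩)
    (fun _ _ => Finset.mem_coe.2 (Finset.mem_univ _)) ?_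
  intro a ha b hb h
  funext i
  by_cases hi : i.val < d
  · rw [(Finset.mem_filter.1 ha).2 i hi, (Finset.mem_filter.1 hb).2 i hi]
  · have := congrFun h ⟨i.val - d, by omega⟩
    simp only at this
    convert this using 2 <;> (ext; simp only; omega)

/-- The operators `M = ∑ aᵢ Nⁱ` with `β M x = M' y`, where `M'` is the adjoint of `M`, are
few: if `a` and `ω a` both qualify for some `ω` moved by `σ`, then `M x = 0`. -/
theorem card_endComb_eq_le {V : Type*} [AddCommGroup V] [Module F V] [DecidableEq V]
    {q : ℕ} (hq : Fintype.card F = q ^ 2)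
    {σ : F →+* F} {ω : F} (hω : σ ω ≠ ω) {N N' : Module.End F V} {β : F} (hβ : β ≠ 0)
    {d : ℕ} (hdn : d < n) {x y : V} (hd : (N ^ (d + 1)) x = 0) (hx : (N ^ d) x ≠ 0) :
    (Finset.univ.filter fun a : Fin n → F =>
      β • endComb N a x = endComb N' (fun i => σ (a i)) y).card ≤ q ^ (2 * n - (d + 1)) := by
  have h := card_sq_le_of_inter_le
    (S := Finset.univ.filter fun a : Fin n → F =>
      β • endComb N a x = endComb N' (fun i => σ (a i)) y)
    (K := Finset.univ.filter fun a : Fin n → F => ∀ i : Fin n, i.val < d + 1 → a i = 0)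
    (by
      intro s hs t ht
      have hs := (Finset.mem_filter.1 hs).2
      have ht := (Finset.mem_filter.1 ht).2
      refine Finset.mem_filter.2 ⟨Finset.mem_univ _, ?_⟩
      have : (fun i => σ ((s - t) i)) = (fun i => σ (s i)) - fun i => σ (t i) := by
        funext i; simp
      rw [this, endComb_sub, endComb_sub, LinearMap.sub_apply, LinearMap.sub_apply, smul_sub, hs,
        ht])
    (DistribSMul.toAddMonoidHom (Fin n → F) ω)
    (by
      intro s hs hs'
      have hs := (Finset.mem_filter.1 hs).2
      have hs' := (Finset.mem_filter.1 hs').2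
      have hsm : (fun i => σ ((ω • s) i)) = σ ω • fun i => σ (s i) := by
        funext i; simp
      rw [DistribSMul.toAddMonoidHom_apply, hsm, endComb_smul, endComb_smul, LinearMap.smul_apply,
        LinearMap.smul_apply, ← hs, smul_comm β ω, ← sub_eq_zero, ← sub_smul, smul_smul] at hs'
      have h0 : endComb N s x = 0 :=
        (smul_eq_zero.1 hs').resolve_left (mul_ne_zero (sub_ne_zero.2 hω.symm) hβ)
      refine Finset.mem_filter.2 ⟨Finset.mem_univ _, fun i hi => ?_⟩
      exact coeff_eq_zero_of_endComb_apply_eq_zero hd hx h0 i.val i.isLt (by omega))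
  have h2 := h.trans (Nat.mul_le_mul_right _ (card_forall_lt_eq_zero_le (d + 1) hdn))
  rw [Fintype.card_fun, Fintype.card_fin, hq, ← pow_mul, ← pow_mul, ← pow_add] at h2
  have hexp : 2 * (n - (d + 1)) + 2 * n = (2 * n - (d + 1)) * 2 := by omega
  rw [hexp, pow_mul] at h2
  exact (Nat.pow_le_pow_iff_left two_ne_zero).1 h2

end Count

/-! ### Existence of codes without words of small weight -/

section Existence

variable {F : Type*} [Field F] [Fintype F] {n : ℕ}

theorem two_le_of_card_eq_sq {q : ℕ} (hq : Fintype.card F = q ^ 2) : 2 ≤ q := by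
  have h : 1 < Fintype.card F := Fintype.one_lt_card
  by_contra hlt
  have : q ≤ 1 := by omega
  have : q ^ 2 ≤ 1 ^ 2 := Nat.pow_le_pow_left this 2
  omega

variable [DecidableEq F]

/-- The sum of the counts over all light pairs is less than the number of admissible operators, so
some operator produces no light pair. -/
theorem exists_endComb_avoiding_lightPairs {q : ℕ} (hq : Fintype.card F = q ^ 2) {σ : F →+* F}
    {ω : F} (hω : σ ω ≠ ω) {β : F} (hβ : β ≠ 0) {lam mu : F} (hlam : lam ≠ 0) (hmu : mu ≠ 0)
    (hn : 0 < n) {K : ℕ} (hK : (20 * Fintype.card F : ℝ) ≤ (4 / 3) ^ K) (hK9 : 9 ≤ K)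
    (N' : Module.End F (Fin n → F)) :
    ∃ a : Fin n → F, a ⟨0, hn⟩ ≠ 0 ∧ ∀ d < n, ∀ z ∈ lightPairs n lam mu K (d + 1),
      ((shiftEnd n lam - mu • 1) ^ d) z.1 ≠ 0 →
      β • endComb (shiftEnd n lam - mu • 1) a z.1 ≠ endComb N' (fun i => σ (a i)) z.2 := by
  set N := shiftEnd n lam - mu • (1 : Module.End F (Fin n → F)) with hN
  have hq2 : 2 ≤ q := two_le_of_card_eq_sq hq
  by_contra! hcon
  let S : (Fin n → F) × (Fin n → F) → Finset (Fin n → F) := fun z => Finset.univ.filter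
    fun a => β • endComb N a z.1 = endComb N' (fun i => σ (a i)) z.2
  let L : ℕ → Finset ((Fin n → F) × (Fin n → F)) := fun d =>
    (lightPairs n lam mu K (d + 1)).filter fun z => (N ^ d) z.1 ≠ 0
  -- Light pairs exist only for `d + 1 ≥ 2 * K ≥ 18`, so the sum starts at `d = 17`.
  have hcover : (Finset.univ.filter fun a : Fin n → F => a ⟨0, hn⟩ ≠ 0)
      ⊆ (Finset.Ico 17 n).biUnion fun d => (L d).biUnion S := by
    intro a ha
    obtain ⟨d, hd, z, hz, hz0, heq⟩ := hcon a (Finset.mem_filter.1 ha).2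
    have h2K := two_mul_le_of_mem_lightPairs hlam hmu hn hd hz (by
      intro h0
      rw [h0, map_zero] at hz0
      exact hz0 rfl)
    refine Finset.mem_biUnion.2 ⟨d, Finset.mem_Ico.2 ⟨by omega, hd⟩, ?_⟩
    exact Finset.mem_biUnion.2 ⟨z, Finset.mem_filter.2 ⟨hz, hz0⟩,
      Finset.mem_filter.2 ⟨Finset.mem_univ _, heq⟩⟩
  have hterm : ∀ d ∈ Finset.Ico 17 n, (((L d).biUnion S).card : ℝ)
      ≤ (3 / 2 * (q : ℝ) ^ (2 * n)) * (3 / 4) ^ d := by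
    intro d hd
    have hdn := (Finset.mem_Ico.1 hd).2
    have h1 : ((L d).biUnion S).card ≤ (L d).card * q ^ (2 * n - (d + 1)) := by
      refine Finset.card_biUnion_le_card_mul _ _ _ fun z hz => ?_
      obtain ⟨hz, hz0⟩ := Finset.mem_filter.1 hz
      exact card_endComb_eq_le hq hω hβ hdn (Finset.mem_filter.1 hz).2.1 hz0
    have h2 : ((L d).card : ℝ) ≤ 2 * (3 / 2) ^ (d + 1) := by
      have h3 := (Finset.card_filter_le (lightPairs n lam mu K (d + 1))
        fun z => (N ^ d) z.1 ≠ 0).trans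
        (card_lightPairs_le hlam hmu (K := K) hn (Nat.succ_pos d) hdn)
      calc ((L d).card : ℝ) ≤ ((2 * (Finset.univ.filter fun v : Fin (d + 1) ⊕ Fin (d + 1) → F =>
            hammingNorm v * K ≤ d + 1).card : ℕ) : ℝ) := by exact_mod_cast h3
        _ ≤ 2 * (3 / 2) ^ (d + 1) := by
          push_cast
          have := card_hammingNorm_mul_le (d := d + 1) hK
          linarith
    have hq2' : (2 : ℝ) ≤ q := by exact_mod_cast hq2
    have h4 : (2 : ℝ) ^ (d + 1) * (q : ℝ) ^ (2 * n - (d + 1)) ≤ (q : ℝ) ^ (2 * n) := by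
      calc (2 : ℝ) ^ (d + 1) * (q : ℝ) ^ (2 * n - (d + 1))
          ≤ (q : ℝ) ^ (d + 1) * (q : ℝ) ^ (2 * n - (d + 1)) := by gcongr
        _ = (q : ℝ) ^ (2 * n) := by rw [← pow_add]; congr 1; omega
    calc (((L d).biUnion S).card : ℝ) ≤ ((L d).card : ℝ) * (q : ℝ) ^ (2 * n - (d + 1)) := by
          exact_mod_cast h1
      _ ≤ 2 * (3 / 2) ^ (d + 1) * (q : ℝ) ^ (2 * n - (d + 1)) := by gcongr
      _ = 2 * (3 / 4) ^ (d + 1) * ((2 : ℝ) ^ (d + 1) * (q : ℝ) ^ (2 * n - (d + 1))) := by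
          have : (3 / 2 : ℝ) = 3 / 4 * 2 := by norm_num
          rw [this, mul_pow]
          ring
      _ ≤ 2 * (3 / 4) ^ (d + 1) * (q : ℝ) ^ (2 * n) := by gcongr
      _ = _ := by rw [pow_succ]; ring
  have hupper : ((Finset.univ.filter fun a : Fin n → F => a ⟨0, hn⟩ ≠ 0).card : ℝ)
      ≤ 1 / 2 * (q : ℝ) ^ (2 * n) := by
    calc ((Finset.univ.filter fun a : Fin n → F => a ⟨0, hn⟩ ≠ 0).card : ℝ)
        ≤ ∑ d ∈ Finset.Ico 17 n, (((L d).biUnion S).card : ℝ) := by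
          exact_mod_cast (Finset.card_le_card hcover).trans Finset.card_biUnion_le
      _ ≤ ∑ d ∈ Finset.Ico 17 n, (3 / 2 * (q : ℝ) ^ (2 * n)) * (3 / 4) ^ d :=
          Finset.sum_le_sum hterm
      _ = (3 / 2 * (q : ℝ) ^ (2 * n)) * ∑ d ∈ Finset.Ico 17 n, (3 / 4 : ℝ) ^ d := by
          rw [Finset.mul_sum]
      _ ≤ (3 / 2 * (q : ℝ) ^ (2 * n)) * ((3 / 4) ^ 17 / (1 - 3 / 4)) := by
          refine mul_le_mul_of_nonneg_left ?_ (by positivity)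
          exact geom_sum_Ico_le_of_lt_one (by norm_num) (by norm_num)
      _ ≤ (3 / 2 * (q : ℝ) ^ (2 * n)) * (1 / 3) := by
          refine mul_le_mul_of_nonneg_left ?_ (by positivity)
          norm_num
      _ = _ := by ring
  have hlower : 3 / 4 * (q : ℝ) ^ (2 * n)
      ≤ ((Finset.univ.filter fun a : Fin n → F => a ⟨0, hn⟩ ≠ 0).card : ℝ) := by
    have h1 : (Finset.univ.filter fun a : Fin n → F => ¬ a ⟨0, hn⟩ ≠ 0).card
        ≤ (q ^ 2) ^ (n - 1) := by
      rw [← hq]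
      refine (Finset.card_le_card ?_).trans (card_forall_lt_eq_zero_le 1 hn)
      intro a ha
      refine Finset.mem_filter.2 ⟨Finset.mem_univ _, fun i hi => ?_⟩
      have : i = ⟨0, hn⟩ := Fin.ext (by simp only; omega)
      rw [this]
      exact not_not.1 (Finset.mem_filter.1 ha).2
    have h2 := Finset.card_filter_add_card_filter_not (s := (Finset.univ : Finset (Fin n → F)))
      (fun a => a ⟨0, hn⟩ ≠ 0)
    rw [Finset.card_univ, Fintype.card_fun, Fintype.card_fin, hq] at h2
    have h3 : 4 * (q ^ 2) ^ (n - 1) ≤ (q ^ 2) ^ n := by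
      calc 4 * (q ^ 2) ^ (n - 1) ≤ q ^ 2 * (q ^ 2) ^ (n - 1) := by
            gcongr
            nlinarith
        _ = (q ^ 2) ^ n := by rw [← pow_succ', Nat.sub_add_cancel hn]
    have h4 : 3 * q ^ (2 * n)
        ≤ 4 * (Finset.univ.filter fun a : Fin n → F => a ⟨0, hn⟩ ≠ 0).card := by
      rw [pow_mul]
      omega
    have h5 : (3 : ℝ) * (q : ℝ) ^ (2 * n)
        ≤ 4 * ((Finset.univ.filter fun a : Fin n → F => a ⟨0, hn⟩ ≠ 0).card : ℝ) := by
      exact_mod_cast h4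
    linarith
  have hpos : (0 : ℝ) < (q : ℝ) ^ (2 * n) := by positivity
  linarith

theorem exists_selfDual_forall_lt_hammingNorm {q : ℕ} (hq : Fintype.card F = q ^ 2)
    {σ : F →+* F} (hσ : ∀ x, σ (σ x) = x) {ω : F} (hω : σ ω ≠ ω) {β : F} (hβ : β * σ β = -1)
    {lam mu : F} (hlam : lam * σ lam = 1) (hmu : mu ≠ 0) (hn : 0 < n)
    (hnil : (shiftEnd n lam - mu • 1) ^ n = 0) {K : ℕ}
    (hK : (20 * Fintype.card F : ℝ) ≤ (4 / 3) ^ K) (hK9 : 9 ≤ K) :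
    ∃ C : Submodule F (Fin n ⊕ Fin n → F), IsTwoQuasiConstacyclic lam C ∧
      (∀ a, a ∈ C ↔ ∀ c ∈ C, sesqForm σ c a = 0) ∧ Module.finrank F C = n ∧
      ∀ c ∈ C, c ≠ 0 → n < 2 * K * hammingNorm c := by
  have hlam0 : lam ≠ 0 := left_ne_zero_of_mul_eq_one hlam
  have hβ0 : β ≠ 0 := by
    rintro rfl
    simp at hβ
  set T := shiftEnd n lam with hT
  set N := T - mu • (1 : Module.End F (Fin n → F)) with hN
  -- The inverse of the shift, which is its adjoint because `lam` has norm one.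
  set T' := lam⁻¹ • T ^ (n - 1) with hT'
  set N' := T' - σ mu • (1 : Module.End F (Fin n → F)) with hN'
  have hTT' : ∀ v, T (T' v) = v := by
    intro v
    rw [hT', LinearMap.smul_apply, map_smul, ← Module.End.mul_apply, ← pow_succ',
      Nat.sub_add_cancel hn, shiftEnd_pow_card]
    simp [hlam0]
  have hadjT : ∀ u v, sesqForm σ (T u) v = sesqForm σ u (T' v) := by
    intro u v
    conv_lhs => rw [← hTT' v]
    exact sesqForm_shiftEnd hlam u (T' v)
  have hadjN : ∀ u v, sesqForm σ (N u) v = sesqForm σ u (N' v) := by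
    intro u v
    have hsub : ∀ a b : Fin n → F, a - b = a + (-1 : F) • b := by
      intro a b
      rw [neg_one_smul, sub_eq_add_neg]
    simp only [hN, hN', LinearMap.sub_apply, LinearMap.smul_apply, Module.End.one_apply, hsub,
      sesqForm_add_left, sesqForm_add_right, sesqForm_smul_left, sesqForm_smul_right, hadjT, hσ,
      map_neg, map_one]
  have hone : ∀ (A : Module.End F (Fin n → F)) (r : F), Commute A (r • 1) := fun A r =>
    (Commute.one_right A).smul_right r
  have hTT'c : Commute T T' := ((Commute.refl T).pow_right _).smul_right _
  have hTN : Commute T N := (Commute.refl T).sub_right (hone T mu)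
  have hTN' : Commute T N' := hTT'c.sub_right (hone T _)
  have hNN' : Commute N N' := hTN'.sub_left (hone N' mu).symm
  obtain ⟨a, ha0, ha⟩ := exists_endComb_avoiding_lightPairs hq hω hβ0 hlam0 hmu hn hK hK9 N'
  set M := endComb N a with hM
  set M' := endComb N' (fun i => σ (a i)) with hM'
  have hadj : ∀ u v, sesqForm σ (M u) v = sesqForm σ u (M' v) :=
    sesqForm_endComb_adjoint hσ hadjN a
  have hMinj : Function.Injective M := endComb_injective hnil hn ha0
  have hM'inj : Function.Injective M' := adjoint_injective hadj hMinj
  have hNM' : Commute N M' := commute_endComb hNN' _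
  have hMM' : Commute M M' := (commute_endComb hNM'.symm a).symm
  refine ⟨pairCode M M' β, isTwoQuasiConstacyclic_pairCode (commute_endComb hTN _)
    (commute_endComb hTN' _), mem_pairCode_iff_of_adjoint hσ hadj hMM' hM'inj hβ, ?_, ?_⟩
  · rw [finrank_pairCode hM'inj, Fintype.card_fin]
  · intro c hc hc0
    by_contra! hlt
    obtain ⟨v, rfl⟩ := mem_pairCode.1 hc
    have hv : v ≠ 0 := by
      rintro rfl
      apply hc0
      funext i
      rcases i with i | i <;> simp
    have hx : M' v ≠ 0 := fun h => hv (hM'inj (h.trans (map_zero _).symm))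
    obtain ⟨d, hdn, h1, h2⟩ := exists_pow_apply_ne_zero hnil hx
    have hNd : (N ^ (d + 1)) v = 0 := by
      apply hM'inj
      rw [map_zero, ← h1, ← Module.End.mul_apply, ← Module.End.mul_apply,
        (hNM'.pow_left (d + 1)).eq]
    have hNM : Commute N M := commute_endComb (Commute.refl N) _
    refine ha d hdn (M' v, β • M v) (Finset.mem_filter.2 ⟨Finset.mem_univ _, h1, ?_, ?_⟩) h2 ?_
    · simp only
      rw [map_smul, ← Module.End.mul_apply, (hNM.pow_left (d + 1)).eq, Module.End.mul_apply, hNd,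
        map_zero, smul_zero]
    · rwa [hammingNorm_sumElim] at hlt
    · change β • M (M' v) = M' (β • M v)
      rw [map_smul, ← Module.End.mul_apply, hMM'.eq, Module.End.mul_apply]

end Existence

/-! ### The norm map of a quadratic extension of finite fields -/

section FieldFacts

variable {F : Type*} [Field F] [Fintype F]

theorem exists_pow_ne_self {q : ℕ} (hq : Fintype.card F = q ^ 2) : ∃ ω : F, ω ^ q ≠ ω := by
  classical
  have hq2 := two_le_of_card_eq_sq hq
  obtain ⟨g, hg⟩ := IsCyclic.exists_generator (α := Fˣ)
  refine ⟨g, fun h => ?_⟩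
  have h1 : g ^ (q - 1) = 1 := by
    have : g ^ q = g := Units.ext (by simpa using h)
    rw [← Nat.sub_add_cancel (by omega : 1 ≤ q), pow_succ] at this
    exact mul_eq_right.1 this
  have h2 := Nat.le_of_dvd (by omega) (orderOf_dvd_of_pow_eq_one h1)
  rw [orderOf_eq_card_of_forall_mem_zpowers hg, Nat.card_eq_fintype_card, Fintype.card_units,
    hq] at h2
  have : 2 * q ≤ q ^ 2 := by nlinarith
  omega

theorem exists_mul_pow_eq_neg_one {q : ℕ} (hq : Fintype.card F = q ^ 2)
    (hneg : (-1 : F) ^ q = -1) : ∃ β : F, β * β ^ q = -1 := by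
  classical
  have hq2 := two_le_of_card_eq_sq hq
  obtain ⟨g, hg⟩ := IsCyclic.exists_generator (α := Fˣ)
  obtain ⟨m, hm⟩ := (mem_powers_iff_mem_zpowers (x := g)).2 (hg (-1))
  simp only at hm
  have h1 : g ^ (m * (q - 1)) = 1 := by
    rw [pow_mul, hm]
    have : (-1 : Fˣ) ^ q = -1 := Units.ext (by simpa using hneg)
    rw [← Nat.sub_add_cancel (by omega : 1 ≤ q), pow_succ] at this
    exact mul_eq_right.1 this
  have h2 := orderOf_dvd_of_pow_eq_one h1
  have h3 : q ^ 2 - 1 = (q + 1) * (q - 1) := by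
    obtain ⟨r, rfl⟩ : ∃ r, q = r + 1 := ⟨q - 1, by omega⟩
    simp only [Nat.add_sub_cancel]
    rw [Nat.sub_eq_iff_eq_add (by nlinarith)]
    ring
  rw [orderOf_eq_card_of_forall_mem_zpowers hg, Nat.card_eq_fintype_card, Fintype.card_units,
    hq, h3] at h2
  obtain ⟨r, rfl⟩ := Nat.dvd_of_mul_dvd_mul_right (by omega) h2
  refine ⟨((g ^ r : Fˣ) : F), ?_⟩
  have h4 := congrArg (Units.val) hm
  rw [← pow_succ', ← Units.val_pow_eq_pow_val, ← pow_mul, mul_comm r, h4]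
  simp

end FieldFacts

/-! ### The class of Hermitian self-dual codes -/

section Hermitian

variable {F : Type*} [Field F]

theorem isHermitianSelfDual_iff {ι : Type*} [Fintype ι] {p ℓ : ℕ} {σ : F →+* F}
    (hσ : ∀ x, σ x = x ^ p ^ (ℓ / 2)) (C : Submodule F (ι → F)) :
    IsHermitianSelfDual p ℓ C ↔ ∀ a, a ∈ C ↔ ∀ c ∈ C, sesqForm σ c a = 0 := by
  simp only [IsHermitianSelfDual, IsGaloisSelfDual, Set.ext_iff, galoisDual, galoisInner, sesqForm,
    hσ, SetLike.mem_coe, Set.mem_ofPred_eq]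

theorem eq_one_of_asymptoticallyGood [DecidableEq F] {p ℓ : ℕ} {σ : F →+* F}
    (hσ : ∀ x, σ x = x ^ p ^ (ℓ / 2)) (hσσ : ∀ x, σ (σ x) = x) {lam : F} (hlam : lam ≠ 0)
    (h : AsymptoticallyGood (hermitianSelfDualTwoQuasi F p ℓ lam)) : lam * σ lam = 1 := by
  obtain ⟨n, C, hC, htend, δ, hδ, hgood⟩ := h
  by_contra hne
  have hσlam : σ lam ≠ 0 := (map_ne_zero σ).2 hlam
  have hmu : lam * σ (σ lam)⁻¹ = 1 := by
    rw [map_inv₀, hσσ, mul_inv_cancel₀ hlam]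
  have hlm : lam ≠ (σ lam)⁻¹ := by
    intro heq
    apply hne
    nth_rewrite 1 [heq]
    exact inv_mul_cancel₀ hσlam
  obtain ⟨i, hi⟩ := (htend.eventually_gt_atTop ⌈2 / δ⌉₊).exists
  obtain ⟨hn, hquasi, hself⟩ := hC i
  obtain ⟨hrate, hdist⟩ := hgood i
  have hbot : C i ≠ ⊥ := by
    intro h0
    rw [codeRate, h0, finrank_bot] at hrate
    simp only [Nat.cast_zero, zero_div] at hrate
    linarith
  have hw := minWeight_le_two_of_pairShift_mem hlm (fun a ha => hquasi a ha)
    (fun a ha => pairShift_mem_of_selfDual hlam hmu hquasi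
      ((isHermitianSelfDual_iff hσ _).1 hself) ha) hbot
  have hcard : 2 / δ < (Fintype.card (Fin (n i) ⊕ Fin (n i)) : ℝ) :=
    (Nat.le_ceil _).trans_lt (by exact_mod_cast hi)
  have hpos : (0 : ℝ) < (Fintype.card (Fin (n i) ⊕ Fin (n i)) : ℝ) :=
    lt_trans (by positivity) hcard
  rw [relMinDist, lt_div_iff₀ hpos] at hdist
  rw [div_lt_iff₀ hδ] at hcard
  have hw' : (minWeight (C i) : ℝ) ≤ 2 := by exact_mod_cast hw
  linarith

theorem asymptoticallyGood_of_eq_one [Fintype F] [DecidableEq F] {p ℓ : ℕ} [Fact p.Prime]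
    [CharP F p] {σ : F →+* F} (hσ : ∀ x, σ x = x ^ p ^ (ℓ / 2)) (hσσ : ∀ x, σ (σ x) = x)
    (hq : Fintype.card F = (p ^ (ℓ / 2)) ^ 2) {lam : F} (hlam : lam * σ lam = 1) :
    AsymptoticallyGood (hermitianSelfDualTwoQuasi F p ℓ lam) := by
  have hlam0 : lam ≠ 0 := left_ne_zero_of_mul_eq_one hlam
  obtain ⟨ω, hω⟩ := exists_pow_ne_self hq
  obtain ⟨β, hβ⟩ := exists_mul_pow_eq_neg_one hq (by rw [← hσ, map_neg, map_one])
  rw [← hσ] at hω hβ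
  obtain ⟨K₀, hK₀⟩ := pow_unbounded_of_one_lt (20 * Fintype.card F : ℝ)
    (by norm_num : (1 : ℝ) < 4 / 3)
  set K := K₀ + 9 with hKdef
  have hK : (20 * Fintype.card F : ℝ) ≤ (4 / 3) ^ K :=
    hK₀.le.trans (pow_le_pow_right₀ (by norm_num) (by omega))
  have hp1 : 1 < p := (Fact.out : p.Prime).one_lt
  have hex : ∀ k : ℕ, ∃ C : Submodule F (Fin (p ^ (k + 1)) ⊕ Fin (p ^ (k + 1)) → F),
      IsTwoQuasiConstacyclic lam C ∧ (∀ a, a ∈ C ↔ ∀ c ∈ C, sesqForm σ c a = 0) ∧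
      Module.finrank F C = p ^ (k + 1) ∧
      ∀ c ∈ C, c ≠ 0 → p ^ (k + 1) < 2 * K * hammingNorm c := by
    intro k
    obtain ⟨mu, hmu⟩ := (iterateFrobeniusEquiv F p (k + 1)).surjective lam
    rw [iterateFrobeniusEquiv_apply, iterateFrobenius_def] at hmu
    have hmu0 : mu ≠ 0 := by
      rintro rfl
      rw [zero_pow (pow_ne_zero _ (by omega))] at hmu
      exact hlam0 hmu.symm
    exact exists_selfDual_forall_lt_hammingNorm hq hσσ hω hβ hlam hmu0
      (pow_pos (by omega) _) (shiftEnd_sub_pow_eq_zero hmu) hK (by omega)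
  choose C hquasi hself hrank hwt using hex
  have hn1 : ∀ k, 1 < p ^ (k + 1) := fun k => Nat.one_lt_pow (by omega) hp1
  have hcard : ∀ k, Fintype.card (Fin (p ^ (k + 1)) ⊕ Fin (p ^ (k + 1))) = 2 * p ^ (k + 1) := by
    intro k
    simp [two_mul]
  refine ⟨fun k => p ^ (k + 1), C, fun k => ⟨hn1 k, hquasi k,
    (isHermitianSelfDual_iff hσ _).2 (hself k)⟩, ?_, (4 * K : ℝ)⁻¹, by positivity, fun k => ?_⟩
  · refine tendsto_atTop_mono (fun k => ?_) tendsto_id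
    rw [hcard]
    have := Nat.lt_pow_self hp1 (n := k + 1)
    simp only [id]
    omega
  have hnpos : (0 : ℝ) < (p ^ (k + 1) : ℕ) := by exact_mod_cast (zero_lt_one.trans (hn1 k))
  have hKge : (9 : ℝ) ≤ K := by exact_mod_cast (by omega : 9 ≤ K)
  constructor
  · rw [codeRate, hrank, hcard, Nat.cast_mul, Nat.cast_ofNat, lt_div_iff₀ (by positivity),
      inv_mul_lt_iff₀ (by positivity)]
    nlinarith
  · have hne : {w : ℕ | ∃ c ∈ C k, c ≠ 0 ∧ hammingNorm c = w}.Nonempty := by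
      have hbot : C k ≠ ⊥ := by
        intro h0
        have := hrank k
        rw [h0, finrank_bot] at this
        have := hn1 k
        omega
      obtain ⟨c, hc, hc0⟩ := (C k).ne_bot_iff.1 hbot
      exact ⟨_, c, hc, hc0, rfl⟩
    obtain ⟨c, hc, hc0, hcw⟩ := Nat.sInf_mem hne
    have hlt := hwt k c hc hc0
    rw [hcw] at hlt
    change p ^ (k + 1) < 2 * K * minWeight (C k) at hlt
    have hlt' : ((p ^ (k + 1) : ℕ) : ℝ) < 2 * K * minWeight (C k) := by exact_mod_cast hlt
    rw [relMinDist, hcard, Nat.cast_mul, Nat.cast_ofNat, lt_div_iff₀ (by positivity),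
      inv_mul_lt_iff₀ (by positivity)]
    linarith

end Hermitian

theorem mainTheorem1 {F : Type*} [Field F] [Fintype F] [DecidableEq F] (p ℓ : ℕ)
    (hp : p.Prime) (hcard : Fintype.card F = p ^ ℓ) (hℓ : Even ℓ) (lam : F) (hlam : lam ≠ 0) :
    AsymptoticallyGood (hermitianSelfDualTwoQuasi F p ℓ lam) ↔ lam ^ (1 + p ^ (ℓ / 2)) = 1 := by
  have : Fact p.Prime := ⟨hp⟩
  have : CharP F p := charP_of_card_eq_prime_pow hcard
  have hq : Fintype.card F = (p ^ (ℓ / 2)) ^ 2 := by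
    rw [hcard, ← pow_mul, Nat.div_mul_cancel hℓ.two_dvd]
  have hσ : ∀ x : F, iterateFrobenius F p (ℓ / 2) x = x ^ p ^ (ℓ / 2) := iterateFrobenius_def p _
  have hσσ : ∀ x : F, iterateFrobenius F p (ℓ / 2) (iterateFrobenius F p (ℓ / 2) x) = x := by
    intro x
    rw [hσ, hσ, ← pow_mul, ← sq, ← hq, FiniteField.pow_card]
  rw [pow_add, pow_one, ← hσ]
  exact ⟨eq_one_of_asymptoticallyGood hσ hσσ hlam, asymptoticallyGood_of_eq_one hσ hσσ hq⟩
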